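/- For an integer $k\ge 2$ let $P_k$ be the path with $k$ vertices and $k-1$ edges. A $P_k$-design of order $n$ is a set $\mathcal B$ of subgraphs of the complete graph $K_n$ on a set $V$ of $n$ vertices, each isomorphic to $P_k$ (the blocks), whose edge sets partition the edge set of $K_n$. A $P_k$-design $\mathcal B$ on $V$ is embedded into a $P_k$-design $\mathcal B'$ on a set $W\supseteq V$ if $\mathcal B\subseteq\mathcal B'$. **Theorem 3.3.** Let $k\ge 2$ be an even integer, and let $n\ge 0$ and $m$ be integers with $n\equiv 0$ or $1\pmod{k-1}$, $m\equiv 0$ or $1\pmod{k-1}$, $m>n+1$ and $m\ge k$ (the last condition follows from the others if a $P_k$-design of order $n$ exists and $n\ge 2$). Then every $P_k$-design of order $n$ can be embedded into a $P_k$-design of order $m$. More precisely, if $\mathcal B$ is a $P_k$-design on a set $V$ with $|V|=n$ and $W\supseteq V$ is a set with $|W|=m$, then there is a $P_k$-design $\mathcal B'$ on $W$ with $\mathcal B\subseteq\mathcal B'$. -/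

import Mathlib

universe u v w

/-- `𝓑` is a `(K, Γ)`-design (a `Γ`-decomposition of `K`): a set of subgraphs of `K` (the blocks),
each isomorphic to `Γ`, whose edge sets partition the edge set of `K`. -/
def IsGraphDesign {V : Type u} {U : Type v} (K : SimpleGraph V) (Γ : SimpleGraph U)
    (𝓑 : Set K.Subgraph) : Prop :=
  (∀ B ∈ 𝓑, Nonempty (B.coe ≃g Γ)) ∧ ∀ e ∈ K.edgeSet, ∃! B, B ∈ 𝓑 ∧ e ∈ B.edgeSet

/-- A `P_k`-design on the vertex set `V`, that is, a `(K_V, P_k)`-design, where `K_V` is the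
complete graph on `V` and `P_k` is the path with `k` vertices and `k - 1` edges.
Its order is the number of elements of `V`. -/
def IsPathDesign (k : ℕ) {V : Type u} (𝓑 : Set (SimpleGraph.completeGraph V).Subgraph) : Prop :=
  IsGraphDesign (SimpleGraph.completeGraph V) (SimpleGraph.pathGraph k) 𝓑

/-- Regarding `V` as a subset of `W` through the injection `f`, every block of `𝓑` is a
block of `𝓑'`. -/
def IsEmbeddedInDesign {V : Type u} {W : Type w} (f : V ↪ W)
    (𝓑 : Set (SimpleGraph.completeGraph V).Subgraph)
    (𝓑' : Set (SimpleGraph.completeGraph W).Subgraph) : Prop :=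
  ∀ B ∈ 𝓑, B.map (SimpleGraph.Embedding.completeGraph f).toHom ∈ 𝓑'

/-! It suffices to decompose the edges of `W` outside `V` into paths with `q = k - 1 = 2 * r + 1`
edges; the given blocks are then kept. The orders involved are `a * q` and `a * q + 1`, and vertices
are added in batches `D` of size `q - 1`, `q` or `q + 1` (`step_zero_one`, `step_one_one`,
`step_zero_zero`, `step_one_zero`), intermediate orders being `1` modulo `q`.

In each step the edges inside `D`, with edges to at most two old vertices, are covered by
Hamiltonian zigzag paths. The remaining edges join `D` to old vertices and are cut into bipartite
graphs, almost all with `q` old vertices, covered by translates of one alternating path.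

Partitions are checked by counting (`of_family`): edge-disjoint paths inside `E` with at least `#E`
edges in total cover `E`. -/

open SimpleGraph in
/-- The edge set `E` is partitioned by the edge sets of a set of paths with `k` vertices. -/
def IsPathDecomposable (k : ℕ) {W : Type w} (E : Set (Sym2 W)) : Prop :=
  ∃ 𝓑 : Set (completeGraph W).Subgraph,
    (∀ B ∈ 𝓑, Nonempty (B.coe ≃g pathGraph k) ∧ B.edgeSet ⊆ E) ∧
      ∀ e ∈ E, ∃! B, B ∈ 𝓑 ∧ e ∈ B.edgeSet

/-! ### Decompositions of edge sets and the reduction to the edges outside `V`. -/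

namespace IsPathDecomposable

open SimpleGraph Finset

variable {k : ℕ} {W : Type w}

theorem empty : IsPathDecomposable k (∅ : Set (Sym2 W)) := ⟨∅, by simp, by simp⟩

theorem union {E F : Set (Sym2 W)} (hE : IsPathDecomposable k E) (hF : IsPathDecomposable k F)
    (h : Disjoint E F) : IsPathDecomposable k (E ∪ F) := by
  obtain ⟨𝓐, hA, hA'⟩ := hE
  obtain ⟨𝓑, hB, hB'⟩ := hF
  rw [Set.disjoint_left] at h
  refine ⟨𝓐 ∪ 𝓑, ?_, ?_⟩
  · rintro B (hb | hb)
    · exact ⟨(hA B hb).1, (hA B hb).2.trans Set.subset_union_left⟩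
    · exact ⟨(hB B hb).1, (hB B hb).2.trans Set.subset_union_right⟩
  · rintro e (he | he)
    · obtain ⟨B, ⟨hb, hb'⟩, hu⟩ := hA' e he
      refine ⟨B, ⟨Or.inl hb, hb'⟩, ?_⟩
      rintro C ⟨hc | hc, hc'⟩
      · exact hu C ⟨hc, hc'⟩
      · exact absurd ((hB C hc).2 hc') (h he)
    · obtain ⟨B, ⟨hb, hb'⟩, hu⟩ := hB' e he
      refine ⟨B, ⟨Or.inr hb, hb'⟩, ?_⟩
      rintro C ⟨hc | hc, hc'⟩
      · exact absurd he (h ((hA C hc).2 hc'))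
      · exact hu C ⟨hc, hc'⟩

/-- A family of injective vertex sequences in `E`, no two of which share an edge, and
with at least as many edges altogether as `E`, decomposes `E`. -/
theorem of_family {ι : Type*} [Fintype ι] {q : ℕ} (p : ι → ℕ → W) (E : Finset (Sym2 W))
    (hinj : ∀ i, ∀ a ≤ q, ∀ b ≤ q, p i a = p i b → a = b)
    (hmem : ∀ i, ∀ j < q, s(p i j, p i (j + 1)) ∈ E)
    (hdisj : ∀ i i', ∀ j < q, ∀ j' < q,
      s(p i j, p i (j + 1)) = s(p i' j', p i' (j' + 1)) → i = i')
    (hcard : #E ≤ Fintype.card ι * q) : IsPathDecomposable (q + 1) (E : Set (Sym2 W)) := by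
  classical
  have hpinj (i : ι) : Function.Injective fun j : Fin (q + 1) => p i j := fun a b hab =>
    Fin.ext (hinj i a (by omega) b (by omega) hab)
  let c (i : ι) : Copy (pathGraph (q + 1)) (completeGraph W) :=
    ⟨⟨fun j => p i j, fun {a b} hab => by
      simpa using fun h => hab.ne (hpinj i h)⟩, hpinj i⟩
  have hc (i : ι) (e : Sym2 W) :
      e ∈ (c i).toSubgraph.edgeSet ↔ ∃ j < q, s(p i j, p i (j + 1)) = e := by
    rw [Copy.toSubgraph, Subgraph.edgeSet_map]
    simp only [Subgraph.edgeSet_top, Set.mem_image]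
    constructor
    · rintro ⟨e, he, rfl⟩
      induction e with | _ a b =>
      rw [mem_edgeSet, pathGraph_adj] at he
      rcases he with he | he
      · exact ⟨a, by omega, by rw [he]; rfl⟩
      · exact ⟨b, by omega, by rw [he, Sym2.eq_swap]; rfl⟩
    · rintro ⟨j, hj, rfl⟩
      refine ⟨s(⟨j, by omega⟩, ⟨j + 1, by omega⟩), ?_, rfl⟩
      rw [mem_edgeSet, pathGraph_adj]
      simp
  have hsurj : ∀ e ∈ E, ∃ i, ∃ j < q, s(p i j, p i (j + 1)) = e := by
    intro e he
    obtain ⟨x, hxq, hx⟩ := Finset.surj_on_of_inj_on_of_card_le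
      (s := (univ : Finset ι) ×ˢ range q) (t := E)
      (fun x _ => s(p x.1 x.2, p x.1 (x.2 + 1)))
      (fun x hx => hmem _ _ (by simpa using hx))
      -- Inside one path an edge determines its position: a reversed match would give `j = j' + 1`
      -- and `j + 1 = j'`.
      (fun x y hx hy hxy => by
        have hx : x.2 < q := by simpa using hx
        have hy : y.2 < q := by simpa using hy
        have h1 := hdisj _ _ _ hx _ hy hxy
        rw [h1, Sym2.eq_iff] at hxy
        refine Prod.ext h1 ?_
        rcases hxy with h | h
        · exact hinj _ _ hx.le _ hy.le h.1
        · have := hinj _ _ hx.le _ hy h.1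
          have := hinj _ _ hx _ hy.le h.2
          omega)
      (by simpa [card_product] using hcard) e he
    exact ⟨x.1, x.2, by simpa using hxq, hx.symm⟩
  refine ⟨Set.range fun i => (c i).toSubgraph, ?_, ?_⟩
  · rintro _ ⟨i, rfl⟩
    refine ⟨⟨(c i).isoToSubgraph.symm⟩, fun e he => ?_⟩
    obtain ⟨j, hj, rfl⟩ := (hc i e).1 he
    exact hmem i j hj
  · intro e he
    obtain ⟨i, j, hj, rfl⟩ := hsurj e he
    refine ⟨(c i).toSubgraph, ⟨⟨i, rfl⟩, (hc _ _).2 ⟨j, hj, rfl⟩⟩, ?_⟩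
    rintro _ ⟨⟨i', rfl⟩, h⟩
    obtain ⟨j', hj', h⟩ := (hc _ _).1 h
    rw [hdisj _ _ _ hj' _ hj h]

/-- A path decomposition of the edges of `W` outside the image of `V` extends a path design on `V`
to a path design on `W`. -/
theorem exists_embedding {V : Type u} {f : V ↪ W} {𝓑 : Set (completeGraph V).Subgraph}
    (h𝓑 : IsPathDesign k 𝓑)
    (h : IsPathDecomposable k ({e | ¬ e.IsDiag} \ Set.range (Sym2.map f))) :
    ∃ 𝓑' : Set (completeGraph W).Subgraph, IsPathDesign k 𝓑' ∧ IsEmbeddedInDesign f 𝓑 𝓑' := by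
  obtain ⟨𝓒, hC, hC'⟩ := h
  let φ : completeGraph V →g completeGraph W := (Embedding.completeGraph f).toHom
  have hφ : ⇑φ = f := rfl
  have hf : Function.Injective (Sym2.map f) := Sym2.map.injective f.injective
  refine ⟨(fun B => B.map φ) '' 𝓑 ∪ 𝓒, ⟨?_, ?_⟩, fun B hB => Or.inl ⟨B, hB, rfl⟩⟩
  · rintro _ (⟨B, hB, rfl⟩ | hB)
    · obtain ⟨g⟩ := h𝓑.1 B hB
      let c : Copy (completeGraph V) (completeGraph W) := (Embedding.completeGraph f).toCopy
      exact ⟨(c.isoSubgraphMap B).symm.trans g⟩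
    · exact (hC _ hB).1
  · intro e he
    by_cases hr : e ∈ Set.range (Sym2.map f)
    · obtain ⟨e, rfl⟩ := hr
      have he' : e ∈ (completeGraph V).edgeSet := by
        induction e with | _ a b => simpa using he
      obtain ⟨B, ⟨hB, hB'⟩, hu⟩ := h𝓑.2 e he'
      refine ⟨B.map φ, ⟨Or.inl ⟨B, hB, rfl⟩, ?_⟩, ?_⟩
      · rw [Subgraph.edgeSet_map]; exact ⟨e, hB', rfl⟩
      · rintro _ ⟨⟨D, hD, rfl⟩ | hD, hD'⟩
        · simp only [Subgraph.edgeSet_map, hφ] at hD'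
          rw [hu D ⟨hD, (hf.mem_set_image).1 hD'⟩]
        · exact absurd ⟨e, rfl⟩ ((hC _ hD).2 hD').2
    · have he' : e ∈ {e : Sym2 W | ¬ e.IsDiag} \ Set.range (Sym2.map f) := by
        refine ⟨?_, hr⟩
        induction e with | _ a b => simpa using he
      obtain ⟨B, ⟨hB, hB'⟩, hu⟩ := hC' e he'
      refine ⟨B, ⟨Or.inr hB, hB'⟩, ?_⟩
      rintro _ ⟨⟨D, hD, rfl⟩ | hD, hD'⟩
      · simp only [Subgraph.edgeSet_map, hφ] at hD'
        exact absurd (Set.image_subset_range _ _ hD') hr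
      · exact hu _ ⟨hD, hD'⟩

end IsPathDecomposable

open Finset

/-! ### Edge sets of complete graphs, bipartite graphs and stars. -/

section EdgeSets

variable {W : Type w} [DecidableEq W]

/-- The edges of the complete graph on `C`. -/
def completeEdges (C : Finset W) : Finset (Sym2 W) := C.offDiag.image fun x => s(x.1, x.2)

/-- The edges of the complete bipartite graph with parts `X` and `Y`. -/
def bipartiteEdges (X Y : Finset W) : Finset (Sym2 W) := (X ×ˢ Y).image fun x => s(x.1, x.2)

/-- The edges joining each `x ∈ X` to `g x`. -/
def graphEdges (X : Finset W) (g : W → W) : Finset (Sym2 W) := X.image fun x => s(x, g x)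

theorem mk_mem_completeEdges {C : Finset W} {a b : W} :
    s(a, b) ∈ completeEdges C ↔ a ∈ C ∧ b ∈ C ∧ a ≠ b := by
  simp only [completeEdges, mem_image, mem_offDiag, Prod.exists, Sym2.eq_iff]
  constructor
  · rintro ⟨x, y, ⟨hx, hy, hxy⟩, ⟨rfl, rfl⟩ | ⟨rfl, rfl⟩⟩
    · exact ⟨hx, hy, hxy⟩
    · exact ⟨hy, hx, hxy.symm⟩
  · rintro ⟨ha, hb, hab⟩
    exact ⟨a, b, ⟨ha, hb, hab⟩, Or.inl ⟨rfl, rfl⟩⟩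

theorem mk_mem_bipartiteEdges {X Y : Finset W} {a b : W} :
    s(a, b) ∈ bipartiteEdges X Y ↔ a ∈ X ∧ b ∈ Y ∨ b ∈ X ∧ a ∈ Y := by
  simp only [bipartiteEdges, mem_image, mem_product, Prod.exists, Sym2.eq_iff]
  constructor
  · rintro ⟨x, y, ⟨hx, hy⟩, ⟨rfl, rfl⟩ | ⟨rfl, rfl⟩⟩
    · exact Or.inl ⟨hx, hy⟩
    · exact Or.inr ⟨hx, hy⟩
  · rintro (⟨ha, hb⟩ | ⟨hb, ha⟩)
    · exact ⟨a, b, ⟨ha, hb⟩, Or.inl ⟨rfl, rfl⟩⟩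
    · exact ⟨b, a, ⟨hb, ha⟩, Or.inr ⟨rfl, rfl⟩⟩

theorem mk_mem_graphEdges {X : Finset W} {g : W → W} {a b : W} :
    s(a, b) ∈ graphEdges X g ↔ a ∈ X ∧ g a = b ∨ b ∈ X ∧ g b = a := by
  simp only [graphEdges, mem_image, Sym2.eq_iff]
  constructor
  · rintro ⟨x, hx, ⟨rfl, rfl⟩ | ⟨rfl, rfl⟩⟩
    · exact Or.inl ⟨hx, rfl⟩
    · exact Or.inr ⟨hx, rfl⟩
  · rintro (⟨ha, hb⟩ | ⟨hb, ha⟩)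
    · exact ⟨a, ha, Or.inl ⟨rfl, hb⟩⟩
    · exact ⟨b, hb, Or.inr ⟨rfl, ha⟩⟩

theorem two_mul_card_completeEdges (C : Finset W) : 2 * #(completeEdges C) = #C * (#C - 1) := by
  rw [Nat.mul_sub_one, ← offDiag_card]
  exact Sym2.two_mul_card_image_offDiag C

theorem card_bipartiteEdges_le (X Y : Finset W) : #(bipartiteEdges X Y) ≤ #X * #Y :=
  card_image_le.trans (card_product X Y).le

theorem card_graphEdges_le (X : Finset W) (g : W → W) : #(graphEdges X g) ≤ #X :=
  card_image_le

theorem bipartiteEdges_comm (X Y : Finset W) : bipartiteEdges X Y = bipartiteEdges Y X := by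
  ext e
  induction e with | _ a b =>
  simp only [mk_mem_bipartiteEdges]
  tauto

end EdgeSets

/-! ### Cyclic labels and the zigzag. -/

/-- A cyclic enumeration of a nonempty finite set by the integers. -/
theorem exists_cyclic_enumeration {W : Type w} {X : Finset W} (hX : 0 < #X) :
    ∃ φ : ℤ → W, (∀ a, φ a ∈ X) ∧ ∀ a b, φ a = φ b → ((#X : ℕ) : ℤ) ∣ b - a := by
  have : NeZero #X := ⟨hX.ne'⟩
  have e : ZMod #X ≃ X := Fintype.equivOfCardEq (by simp [ZMod.card])
  refine ⟨fun a => e (a : ZMod #X), fun a => (e _).2, fun a b h => ?_⟩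
  exact (ZMod.intCast_eq_intCast_iff_dvd_sub a b #X).1 (e.injective (Subtype.ext h))

/-- The zigzag `0, 1, -1, 2, -2, …`. -/
def zigzag (j : ℕ) : ℤ := if j % 2 = 0 then -(j / 2 : ℕ) else (j / 2 : ℕ) + 1

/-- The invariant separating translates: every edge of the translate by `i` has endpoint sum `2 * i`
or `2 * i + 1`. -/
theorem zigzag_add_succ (j : ℕ) : zigzag j + zigzag (j + 1) = if j % 2 = 0 then 1 else 0 := by
  unfold zigzag
  split_ifs <;> omega

/-- The first `n` terms of the zigzag are `n` consecutive integers in another order. -/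
theorem eq_of_dvd_zigzag_sub {n a b : ℕ} (ha : a < n) (hb : b < n)
    (h : (n : ℤ) ∣ zigzag b - zigzag a) : a = b := by
  have h0 := Int.eq_zero_of_abs_lt_dvd h (by
    rw [abs_lt]; unfold zigzag; split_ifs <;> omega)
  unfold zigzag at h0
  split_ifs at h0 <;> omega

/-- Translates of the zigzag by `i < r` modulo `2 * r` have no edge in common. -/
theorem eq_of_zigzag_translates {r i i' : ℕ} (j j' : ℕ) (hi : i < r) (hi' : i' < r)
    (h : ((2 * r : ℕ) : ℤ) ∣ ((i' + zigzag j') + (i' + zigzag (j' + 1))) -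
      ((i + zigzag j) + (i + zigzag (j + 1)))) : i = i' := by
  have h1 := zigzag_add_succ j
  have h2 := zigzag_add_succ j'
  -- Both sums lie in `[0, 2 * r)`, so congruence is equality, and halving recovers `i`.
  have h0 := Int.eq_zero_of_abs_lt_dvd h (by
    rw [abs_lt]; split_ifs at h1 h2 <;> omega)
  split_ifs at h1 h2 <;> omega

/-! ### Explicit decompositions of complete and bipartite graphs. -/

namespace IsPathDecomposable

variable {W : Type w} [DecidableEq W]

/-- The complete graph of even order decomposes into Hamiltonian paths. -/
theorem completeEdges_of_card_eq {r : ℕ} {C : Finset W} (hC : #C = 2 * r + 2) :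
    IsPathDecomposable (2 * r + 1 + 1) (completeEdges C : Set (Sym2 W)) := by
  obtain ⟨φ, hφC, hφ⟩ := exists_cyclic_enumeration (X := C) (by omega)
  rw [hC] at hφ
  have hinj (i : Fin (r + 1)) (a : ℕ) (ha : a ≤ 2 * r + 1) (b : ℕ) (hb : b ≤ 2 * r + 1)
      (h : φ (i + zigzag a) = φ (i + zigzag b)) : a = b := by
    have := hφ _ _ h
    rw [add_sub_add_left_eq_sub] at this
    exact eq_of_dvd_zigzag_sub (by omega) (by omega) this
  refine of_family (ι := Fin (r + 1)) (fun i j => φ (i + zigzag j)) _ hinj ?_ ?_ ?_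
  · intro i j hj
    refine mk_mem_completeEdges.2 ⟨hφC _, hφC _, fun h => ?_⟩
    have := hinj i j hj.le (j + 1) hj h
    omega
  · intro i i' j hj j' hj' h
    refine Fin.ext (eq_of_zigzag_translates (r := r + 1) j j' i.2 i'.2 ?_)
    rw [show 2 * (r + 1) = 2 * r + 2 by ring]
    rcases Sym2.eq_iff.1 h with ⟨h1, h2⟩ | ⟨h1, h2⟩ <;>
      exact (dvd_add (hφ _ _ h1) (hφ _ _ h2)).trans (dvd_of_eq (by ring))
  · have := two_mul_card_completeEdges C
    rw [hC, show 2 * r + 2 - 1 = 2 * r + 1 by omega] at this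
    rw [Fintype.card_fin]
    nlinarith

/-- The complete graph of order `2 * r`, with an edge from each vertex to one of two
further vertices, decomposes into paths with `2 * r + 1` edges. -/
theorem exists_completeEdges_union_graphEdges {r : ℕ} {D : Finset W} (hD : #D = 2 * r)
    (hr : 0 < r) {v₀ v₁ : W} (hv : v₀ ≠ v₁) (hv₀ : v₀ ∉ D) (hv₁ : v₁ ∉ D) :
    ∃ f : W → W, (∀ x, f x = v₀ ∨ f x = v₁) ∧ IsPathDecomposable (2 * r + 1 + 1)
      ((completeEdges D ∪ graphEdges D f : Finset (Sym2 W)) : Set (Sym2 W)) := by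
  classical
  obtain ⟨φ, hφD, hφ⟩ := exists_cyclic_enumeration (X := D) (by omega)
  rw [hD] at hφ
  have hφ₀ (a) : φ a ≠ v₀ := fun h => hv₀ (h ▸ hφD a)
  have hφ₁ (a) : φ a ≠ v₁ := fun h => hv₁ (h ▸ hφD a)
  -- The zigzag from `φ i` through `D` ends at `φ (i + r)`. For `i < r` these endpoints exhaust `D`;
  -- starts are tied to `v₀` and ends to `v₁`.
  let f (x : W) : W := if ∃ i : Fin r, φ i = x then v₀ else v₁
  have hf₀ (i : Fin r) : f (φ i) = v₀ := if_pos ⟨i, rfl⟩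
  have hlast : zigzag (2 * r - 1) = r := by
    unfold zigzag
    rw [if_neg (by omega)]
    omega
  have hf₁ (i : Fin r) : f (φ (i + r)) = v₁ := by
    refine if_neg ?_
    rintro ⟨i', h⟩
    have h0 := Int.eq_zero_of_abs_lt_dvd (hφ _ _ h) (by rw [abs_lt]; omega)
    omega
  let p (i : Fin r) (j : ℕ) : W :=
    if j = 0 then v₀ else if j = 2 * r + 1 then v₁ else φ (i + zigzag (j - 1))
  have hp0 (i) : p i 0 = v₀ := rfl
  have hpr (i) : p i (2 * r + 1) = v₁ := by simp [p]
  have hp (i) (j : ℕ) (hj : j < 2 * r) : p i (j + 1) = φ (i + zigzag j) := by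
    simp [p, hj.ne]
  have hinj (i : Fin r) (a : ℕ) (ha : a ≤ 2 * r + 1) (b : ℕ) (hb : b ≤ 2 * r + 1)
      (h : p i a = p i b) : a = b := by
    have key (a b : ℕ) (ha : a < 2 * r) (hb : b < 2 * r)
        (h : φ (i + zigzag a) = φ (i + zigzag b)) : a = b := by
      have := hφ _ _ h
      rw [add_sub_add_left_eq_sub] at this
      exact eq_of_dvd_zigzag_sub ha hb this
    have := key (a - 1) (b - 1)
    have := hφ₀ (i + zigzag (a - 1))
    have := hφ₁ (i + zigzag (a - 1))
    have := hφ₀ (i + zigzag (b - 1))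
    have := hφ₁ (i + zigzag (b - 1))
    simp only [p] at h
    split_ifs at h <;> grind
  have hstart (i) : s(p i 0, p i 1) = s(v₀, φ i) := by
    have := hp i 0 (by omega)
    simp only [zero_add] at this
    rw [hp0, this]
    simp [zigzag]
  have hend (i) : s(p i (2 * r), p i (2 * r + 1)) = s(φ (i + r), v₁) := by
    have := hp i (2 * r - 1) (by omega)
    rw [Nat.sub_add_cancel (by omega), hlast] at this
    rw [hpr, this]
  have hmid (i) (j : ℕ) (hj : j ≠ 0) (hj' : j < 2 * r) :
      s(p i j, p i (j + 1)) = s(φ (i + zigzag (j - 1)), φ (i + zigzag (j - 1 + 1))) := by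
    rw [hp i j hj', Nat.sub_add_cancel (by omega), ← hp i (j - 1) (by omega),
      Nat.sub_add_cancel (by omega)]
  refine ⟨f, fun x => by simp only [f]; split_ifs <;> simp, of_family p _ hinj ?_ ?_ ?_⟩
  · intro i j hj
    rw [mem_union]
    by_cases h0 : j = 0
    · subst h0
      right
      rw [hstart, mk_mem_graphEdges]
      exact Or.inr ⟨hφD _, hf₀ i⟩
    by_cases h1 : j = 2 * r
    · subst h1
      right
      rw [hend, mk_mem_graphEdges]
      exact Or.inl ⟨hφD _, hf₁ i⟩
    left
    have hne : p i j ≠ p i (j + 1) := fun h => by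
      have := hinj i j hj.le (j + 1) hj h
      omega
    have := hmid i j h0 (by omega)
    rw [this]
    refine mk_mem_completeEdges.2 ⟨hφD _, hφD _, fun h => hne ?_⟩
    rw [h, Sym2.eq_iff] at this
    grind
  · intro i i' j hj j' hj' h
    have key (s : Sym2 W) (j : ℕ) (i : Fin r) (hj : j < 2 * r + 1)
        (hs : s = s(p i j, p i (j + 1))) :
        s = s(v₀, φ i) ∨ s = s(φ (i + r), v₁) ∨
          ∃ j, s = s(φ (i + zigzag j), φ (i + zigzag (j + 1))) := by
      by_cases h0 : j = 0
      · subst h0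
        exact Or.inl (hs.trans (hstart i))
      by_cases h1 : j = 2 * r
      · subst h1
        exact Or.inr (Or.inl (hs.trans (hend i)))
      exact Or.inr (Or.inr ⟨j - 1, hs.trans (hmid i j h0 (by omega))⟩)
    have hshort (a b : ℤ) (hab : |b - a| < 2 * r) (h : φ a = φ b) : a = b := by
      have := Int.eq_zero_of_abs_lt_dvd (hφ _ _ h) (by exact_mod_cast hab)
      omega
    have k1 := key _ j i hj rfl
    have k2 := key _ j' i' hj' h
    have hii : |((i' : ℕ) : ℤ) - (i : ℕ)| < 2 * r := by rw [abs_lt]; omega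
    rcases k1 with k1 | k1 | ⟨l, k1⟩ <;> rcases k2 with k2 | k2 | ⟨l', k2⟩ <;>
      rw [k1, Sym2.eq_iff] at k2
    · have := hshort i i' hii (by grind)
      omega
    · grind
    · grind
    · grind
    · have := hshort (i + r) (i' + r) (by rwa [add_sub_add_right_eq_sub]) (by grind)
      omega
    · grind
    · grind
    · grind
    · refine Fin.ext (eq_of_zigzag_translates l l' i.2 i'.2 ?_)
      rcases k2 with ⟨h1, h2⟩ | ⟨h1, h2⟩ <;>
      exact (dvd_add (hφ _ _ h1) (hφ _ _ h2)).trans (dvd_of_eq (by ring))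
  · have h1 := two_mul_card_completeEdges D
    have h2 := card_union_le (completeEdges D) (graphEdges D f)
    have h3 := card_graphEdges_le D f
    rw [hD] at h1 h3
    rw [Fintype.card_fin]
    obtain ⟨s, rfl⟩ : ∃ s, r = s + 1 := ⟨r - 1, by omega⟩
    rw [show 2 * (s + 1) - 1 = 2 * s + 1 by omega] at h1
    nlinarith

/-- The complete bipartite graph with two parts of size `q` decomposes into paths with `q` edges. -/
theorem bipartiteEdges_of_card_eq {q : ℕ} (hq : 0 < q) {X Y : Finset W} (hX : #X = q)
    (hY : #Y = q) (hXY : Disjoint X Y) :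
    IsPathDecomposable (q + 1) (bipartiteEdges X Y : Set (Sym2 W)) := by
  obtain ⟨φ, hφX, hφ⟩ := exists_cyclic_enumeration (X := X) (by omega)
  obtain ⟨ψ, hψY, hψ⟩ := exists_cyclic_enumeration (X := Y) (by omega)
  rw [hX] at hφ
  rw [hY] at hψ
  have hne (a b) : φ a ≠ ψ b := fun h =>
    disjoint_left.1 hXY (hφX a) (h ▸ hψY b)
  have hshort (z : ℤ) (hz : (q : ℤ) ∣ z) (h : |z| < q) : z = 0 :=
    Int.eq_zero_of_abs_lt_dvd hz h
  -- The labels on edge `j` differ by `j`, so an edge determines `j`, and then its label in `X`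
  -- determines `i`.
  let p (i : Fin q) (j : ℕ) : W :=
    if j % 2 = 0 then φ (i - (j / 2 : ℕ)) else ψ (i + (j / 2 : ℕ))
  have hedge (i : Fin q) (j : ℕ) : ∃ a b : ℤ, s(p i j, p i (j + 1)) = s(φ a, ψ b) ∧ b - a = j ∧
      a = i - ((j + 1) / 2 : ℕ) := by
    rcases Nat.mod_two_eq_zero_or_one j with h | h
    · refine ⟨i - (j / 2 : ℕ), i + (j / 2 : ℕ), ?_, by omega, by omega⟩
      simp only [p]
      rw [if_pos h, if_neg (by omega), show (j + 1) / 2 = j / 2 by omega]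
    · refine ⟨i - ((j + 1) / 2 : ℕ), i + (j / 2 : ℕ), ?_, by omega, rfl⟩
      simp only [p]
      rw [if_neg (by omega), if_pos (by omega), Sym2.eq_swap]
  refine of_family p _ ?_ ?_ ?_ ?_
  · intro i a ha b hb h
    simp only [p] at h
    split_ifs at h with h1 h2 h2
    · have := hshort _ (hφ _ _ h) (by rw [abs_lt]; omega)
      omega
    · exact absurd h (hne _ _)
    · exact absurd h.symm (hne _ _)
    · have := hshort _ (hψ _ _ h) (by rw [abs_lt]; omega)
      omega
  · intro i j hj
    obtain ⟨a, b, h, -⟩ := hedge i j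
    rw [h, mk_mem_bipartiteEdges]
    exact Or.inl ⟨hφX a, hψY b⟩
  · intro i i' j hj j' hj' h
    obtain ⟨a, b, h1, h2, h3⟩ := hedge i j
    obtain ⟨a', b', h1', h2', h3'⟩ := hedge i' j'
    rw [h1, h1', Sym2.eq_iff] at h
    rcases h with ⟨ha, hb⟩ | ⟨ha, -⟩
    · have hd := dvd_sub (hψ _ _ hb) (hφ _ _ ha)
      have := hshort _ hd (by rw [abs_lt]; omega)
      have := hshort _ (hφ _ _ ha) (by rw [abs_lt]; omega)
      omega
    · exact absurd ha (hne _ _)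
  · simpa [hX, hY] using card_bipartiteEdges_le X Y

/-- A complete bipartite graph with parts `D` of even size and `Y` of size `2 * r < #D`, with one
further edge at each vertex of `D`, decomposes into paths with `2 * r + 1` edges. -/
theorem bipartiteEdges_union_graphEdges {r t : ℕ} (ht : Even t) (hrt : r < t) {D Y : Finset W}
    (hD : #D = t) (hY : #Y = 2 * r) (hDY : Disjoint D Y) (g : W → W) (hgD : ∀ x ∈ D, g x ∉ D)
    (hgY : ∀ x ∈ D, g x ∉ Y) :
    IsPathDecomposable (2 * r + 1 + 1)
      ((bipartiteEdges D Y ∪ graphEdges D g : Finset (Sym2 W)) : Set (Sym2 W)) := by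
  obtain ⟨φ, hφD, hφ⟩ := exists_cyclic_enumeration (X := D) (by omega)
  have e : Fin (2 * r) ≃ Y := Fintype.equivOfCardEq (by simp [hY])
  rw [hD] at hφ
  have hshort (a b : ℤ) (h : φ a = φ b) (hab : |b - a| < t) : a = b := by
    have := Int.eq_zero_of_abs_lt_dvd (hφ _ _ h) hab
    omega
  -- Evenness of `t` makes the parity of a label well defined.
  have hpar (a b : ℤ) (h : φ a = φ b) : a % 2 = b % 2 := by
    obtain ⟨s, rfl⟩ := ht
    have h2 : (2 : ℤ) ∣ b - a := dvd_trans ⟨s, by push_cast; ring⟩ (hφ _ _ h)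
    omega
  let x (i : Fin t) (l : ℕ) : W := φ (i + l)
  have hx (i l) : x i l ∈ D := hφD _
  -- `Y` is split into `r` pairs, and path `i` takes from each the element given by the parity of
  -- `i`. The last vertex is `g` of the last vertex in `D`. The bound `r < t` keeps the `r + 1`
  -- vertices in `D` distinct.
  let y (i : Fin t) (l : ℕ) : W :=
    if h : l < r then e ⟨2 * l + i % 2, by omega⟩ else g (x i r)
  have hy (i) (l : ℕ) (hl : l < r) : y i l = e ⟨2 * l + i % 2, by omega⟩ := dif_pos hl
  have hyr (i) : y i r = g (x i r) := dif_neg (lt_irrefl r)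
  have hyY (i l) (hl : l < r) : y i l ∈ Y := by rw [hy i l hl]; exact (e _).2
  have hyD (i l) : y i l ∉ D := by
    simp only [y]
    split_ifs with h
    · exact disjoint_right.1 hDY (e _).2
    · exact hgD _ (hx i r)
  have hyrY (i) : y i r ∉ Y := by rw [hyr]; exact hgY _ (hx i r)
  have hyinj (i i' l l') (hl : l ≤ r) (hl' : l' ≤ r) (h : y i l = y i' l') :
      l = l' ∧ (l < r → (i : ℕ) % 2 = i' % 2) := by
    rcases hl.lt_or_eq with hl | rfl <;> rcases hl'.lt_or_eq with hl' | rfl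
    · rw [hy i l hl, hy i' l' hl'] at h
      have := congrArg Fin.val (e.injective (Subtype.ext h))
      simp only at this
      omega
    · exact absurd (h ▸ hyY i l hl) (hyrY i')
    · exact absurd (h ▸ hyY i' l' hl') (hyrY i)
    · simp
  let p (i : Fin t) (j : ℕ) : W := if j % 2 = 0 then x i (j / 2) else y i (j / 2)
  have hedge (i : Fin t) (j : ℕ) :
      s(p i j, p i (j + 1)) = s(x i ((j + 1) / 2), y i (j / 2)) := by
    simp only [p]
    rcases Nat.mod_two_eq_zero_or_one j with h | h
    · rw [if_pos h, if_neg (by omega), show (j + 1) / 2 = j / 2 by omega]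
    · rw [if_neg (by omega), if_pos (by omega), Sym2.eq_swap]
  refine of_family p _ ?_ ?_ ?_ ?_
  · intro i a ha b hb h
    simp only [p] at h
    split_ifs at h with h1 h2 h2
    · have := hshort _ _ h (by rw [abs_lt]; omega)
      omega
    · exact absurd (h ▸ hx i _) (hyD i _)
    · exact absurd (h ▸ hx i _) (hyD i _)
    · have := hyinj i i _ _ (by omega) (by omega) h
      omega
  · intro i j hj
    rw [hedge, mem_union]
    by_cases h : j = 2 * r
    · right
      rw [show (j + 1) / 2 = r by omega, show j / 2 = r by omega, hyr, mk_mem_graphEdges]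
      exact Or.inl ⟨hx i r, rfl⟩
    · left
      exact mk_mem_bipartiteEdges.2 (Or.inl ⟨hx i _, hyY i _ (by omega)⟩)
  · intro i i' j hj j' hj' h
    rw [hedge, hedge, Sym2.eq_iff] at h
    rcases h with ⟨h1, h2⟩ | ⟨h1, -⟩
    · obtain ⟨h3, h4⟩ := hyinj i i' _ _ (by omega) (by omega) h2
      have h5 := hpar _ _ h1
      -- The end in `Y` fixes `j / 2` and the parity of `i`; the parity of the label in `D` then
      -- fixes `(j + 1) / 2`.
      have h6 : (j + 1) / 2 = (j' + 1) / 2 := by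
        by_cases h : j / 2 < r
        · have := h4 h
          omega
        · omega
      have := hshort _ _ h1 (by rw [abs_lt]; omega)
      omega
    · exact absurd (h1 ▸ hx i _) (hyD i' _)
  · have h1 := card_union_le (bipartiteEdges D Y) (graphEdges D g)
    have h2 := card_bipartiteEdges_le D Y
    have h3 := card_graphEdges_le D g
    rw [hD] at h2 h3
    rw [hY] at h2
    rw [Fintype.card_fin]
    nlinarith

/-! ### Gluing decompositions. -/

theorem of_eq_union {k : ℕ} {E E₁ E₂ : Finset (Sym2 W)}
    (h₁ : IsPathDecomposable k (E₁ : Set (Sym2 W))) (h₂ : IsPathDecomposable k (E₂ : Set (Sym2 W)))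
    (hE : ∀ a b, s(a, b) ∈ E ↔ s(a, b) ∈ E₁ ∨ s(a, b) ∈ E₂)
    (hd : ∀ a b, s(a, b) ∈ E₁ → s(a, b) ∉ E₂) :
    IsPathDecomposable k (E : Set (Sym2 W)) := by
  have : E = E₁ ∪ E₂ := by
    ext e
    induction e with | _ a b =>
    rw [mem_union, hE]
  rw [this, coe_union]
  refine h₁.union h₂ (Set.disjoint_left.2 fun e => ?_)
  induction e with | _ a b => simpa using hd a b

theorem sdiff_trans {k : ℕ} {A B C : Finset W} (hAB : A ⊆ B) (hBC : B ⊆ C)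
    (h₁ : IsPathDecomposable k
      ((completeEdges B \ completeEdges A : Finset (Sym2 W)) : Set (Sym2 W)))
    (h₂ : IsPathDecomposable k
      ((completeEdges C \ completeEdges B : Finset (Sym2 W)) : Set (Sym2 W))) :
    IsPathDecomposable k ((completeEdges C \ completeEdges A : Finset (Sym2 W)) : Set (Sym2 W)) := by
  refine of_eq_union h₁ h₂ ?_ ?_ <;> intro a b <;> simp only [mem_sdiff, mk_mem_completeEdges] <;>
  · have := @hAB a
    have := @hAB b
    have := @hBC a
    have := @hBC b
    tauto

/-- If `D` together with each `q`-subset of `Y` spans a decomposable complete bipartite graph, then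
so does `D` together with `Y`, provided that `q` divides the size of `Y`. -/
theorem bipartiteEdges_of_card_eq_mul {k q : ℕ} {D : Finset W} (a : ℕ) :
    ∀ Y : Finset W, #Y = a * q → Disjoint D Y →
      (∀ Z ⊆ Y, #Z = q → IsPathDecomposable k (bipartiteEdges D Z : Set (Sym2 W))) →
        IsPathDecomposable k (bipartiteEdges D Y : Set (Sym2 W)) := by
  induction a with
  | zero =>
    intro Y hY _ _
    obtain rfl : Y = ∅ := by simpa using hY
    simpa [bipartiteEdges] using IsPathDecomposable.empty
  | succ a ih =>
    intro Y hY hD h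
    obtain ⟨Z, hZY, hZ⟩ := exists_subset_card_eq (s := Y) (n := q) (by rw [hY]; nlinarith)
    have hc : #(Y \ Z) = a * q := by
      rw [card_sdiff_of_subset hZY, hY, hZ, Nat.succ_mul, Nat.add_sub_cancel]
    refine of_eq_union (h Z hZY hZ) (ih (Y \ Z) hc (disjoint_of_subset_right sdiff_subset hD)
      fun Z' hZ' => h Z' (hZ'.trans sdiff_subset)) ?_ ?_
    · intro x y
      have := @hZY x
      have := @hZY y
      simp only [mk_mem_bipartiteEdges, mem_sdiff]
      tauto
    · intro x y
      have hx := @disjoint_left.1 hD x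
      have hy := @disjoint_left.1 hD y
      have := @hZY x
      have := @hZY y
      simp only [mk_mem_bipartiteEdges, mem_sdiff]
      tauto

variable {r : ℕ}

/-- A complete bipartite graph with parts of sizes `t` even and `2 * r + 1` decomposes into
paths with `2 * r + 1` edges if `r < t`. -/
theorem bipartiteEdges_of_even {t : ℕ} (ht : Even t) (hrt : r < t) {D Y : Finset W}
    (hD : #D = t) (hY : #Y = 2 * r + 1) (hDY : Disjoint D Y) :
    IsPathDecomposable (2 * r + 1 + 1) (bipartiteEdges D Y : Set (Sym2 W)) := by
  obtain ⟨v, hv⟩ : Y.Nonempty := card_pos.1 (by omega)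
  have hvD : v ∉ D := disjoint_right.1 hDY hv
  -- The edges to `v` serve as the further edges, one at each vertex of `D`.
  have key := bipartiteEdges_union_graphEdges ht hrt hD
    (Y := Y.erase v) (by rw [card_erase_of_mem hv, hY]; rfl)
    (disjoint_of_subset_right (erase_subset v Y) hDY) (fun _ => v) (fun _ _ => hvD)
    (fun _ _ => notMem_erase v Y)
  convert key using 2
  ext e
  induction e with | _ a b =>
  simp only [mem_union, mk_mem_bipartiteEdges, mk_mem_graphEdges, mem_erase]
  grind

/-! ### Single steps between admissible orders. -/

/-- From order `a * q` to order `(a + 1) * q + 1`. -/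
theorem step_zero_one {a : ℕ} {A C : Finset W} (hAC : A ⊆ C) (hA : #A = a * (2 * r + 1))
    (hC : #C = (a + 1) * (2 * r + 1) + 1) : IsPathDecomposable (2 * r + 1 + 1)
      ((completeEdges C \ completeEdges A : Finset (Sym2 W)) : Set (Sym2 W)) := by
  have hD : #(C \ A) = 2 * r + 2 := by
    rw [card_sdiff_of_subset hAC, hC, hA, Nat.succ_mul]
    omega
  refine of_eq_union (completeEdges_of_card_eq hD) (bipartiteEdges_of_card_eq_mul a A hA
    sdiff_disjoint fun Z hZ hZ' => bipartiteEdges_of_even ⟨r + 1, by ring⟩ (by omega) hD hZ'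
      (disjoint_of_subset_right hZ sdiff_disjoint)) ?_ ?_ <;> intro x y <;>
    simp only [mem_sdiff, mk_mem_completeEdges, mk_mem_bipartiteEdges]
  · grind
  · grind

/-- Adding `2 * r + 1` vertices to a vertex set containing `v`. -/
theorem sdiff_of_bipartiteEdges_erase {A C : Finset W} {v : W} (hAC : A ⊆ C) (hv : v ∈ A)
    (hD : #(C \ A) = 2 * r + 1) (h : IsPathDecomposable (2 * r + 1 + 1)
      (bipartiteEdges (C \ A) (A.erase v) : Set (Sym2 W))) :
    IsPathDecomposable (2 * r + 1 + 1)
      ((completeEdges C \ completeEdges A : Finset (Sym2 W)) : Set (Sym2 W)) := by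
  -- Lending `v` to the new vertices gives a complete graph of even order `2 * r + 2`.
  refine of_eq_union (completeEdges_of_card_eq (C := insert v (C \ A)) ?_) h ?_ ?_
  · rw [card_insert_of_notMem (by simp [hv]), hD]
  · intro x y
    simp only [mem_sdiff, mk_mem_completeEdges, mk_mem_bipartiteEdges, mem_insert, mem_erase]
    grind
  · intro x y
    simp only [mem_sdiff, mk_mem_completeEdges, mk_mem_bipartiteEdges, mem_insert, mem_erase]
    grind

/-- From order `a * q + 1` to order `(a + 1) * q + 1`. -/
theorem step_one_one {a : ℕ} {A C : Finset W} (hAC : A ⊆ C) (hA : #A = a * (2 * r + 1) + 1)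
    (hC : #C = (a + 1) * (2 * r + 1) + 1) : IsPathDecomposable (2 * r + 1 + 1)
      ((completeEdges C \ completeEdges A : Finset (Sym2 W)) : Set (Sym2 W)) := by
  have hD : #(C \ A) = 2 * r + 1 := by
    rw [card_sdiff_of_subset hAC, hC, hA, Nat.succ_mul]
    omega
  obtain ⟨v, hv⟩ : A.Nonempty := card_pos.1 (by omega)
  have hdis : Disjoint (C \ A) (A.erase v) :=
    disjoint_of_subset_right (erase_subset v A) sdiff_disjoint
  exact sdiff_of_bipartiteEdges_erase hAC hv hD (bipartiteEdges_of_card_eq_mul a _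
    (by rw [card_erase_of_mem hv, hA]; rfl) hdis fun Z hZ hZ' => bipartiteEdges_of_card_eq
      (by omega) hD hZ' (disjoint_of_subset_right hZ hdis))

/-- From order `(a + 1) * q` to order `(a + 2) * q`. -/
theorem step_zero_zero {a : ℕ} (hr : 0 < r) {A C : Finset W} (hAC : A ⊆ C)
    (hA : #A = (a + 1) * (2 * r + 1)) (hC : #C = (a + 2) * (2 * r + 1)) :
    IsPathDecomposable (2 * r + 1 + 1)
      ((completeEdges C \ completeEdges A : Finset (Sym2 W)) : Set (Sym2 W)) := by
  have hD : #(C \ A) = 2 * r + 1 := by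
    rw [card_sdiff_of_subset hAC, hC, hA, show a + 2 = (a + 1) + 1 from rfl, Nat.succ_mul (a + 1)]
    omega
  rw [Nat.succ_mul] at hA
  obtain ⟨v, hv⟩ : A.Nonempty := card_pos.1 (by omega)
  have hdis : Disjoint (C \ A) (A.erase v) :=
    disjoint_of_subset_right (erase_subset v A) sdiff_disjoint
  have hA' : #(A.erase v) = a * (2 * r + 1) + 2 * r := by
    rw [card_erase_of_mem hv, hA]
    omega
  obtain ⟨Y, hY, hYc⟩ := exists_subset_card_eq (s := A.erase v) (n := 2 * r) (by omega)
  have hrest : #(A.erase v \ Y) = a * (2 * r + 1) := by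
    rw [card_sdiff_of_subset hY, hA', hYc, Nat.add_sub_cancel]
  -- The roles are swapped: the old vertices `Y` form the even part, and `2 * r > r` because `r >
  -- 0`.
  have h₁ := bipartiteEdges_of_even (r := r) (t := 2 * r) (even_two_mul r) (by omega) hYc hD
    (disjoint_of_subset_right hY hdis).symm
  rw [bipartiteEdges_comm] at h₁
  have hdis' := disjoint_of_subset_right (sdiff_subset (s := A.erase v) (t := Y)) hdis
  refine sdiff_of_bipartiteEdges_erase hAC hv hD (of_eq_union h₁
    (bipartiteEdges_of_card_eq_mul a _ hrest hdis' fun Z hZ hZ' => bipartiteEdges_of_card_eq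
      (by omega) hD hZ' (disjoint_of_subset_right hZ hdis')) ?_ ?_) <;> intro x y
  · have := @hY x
    have := @hY y
    simp only [mk_mem_bipartiteEdges, mem_sdiff (t := Y)]
    tauto
  · have := @hY x
    have := @hY y
    simp only [mk_mem_bipartiteEdges, mem_sdiff, mem_erase] at *
    tauto

/-- From order `(a + 1) * q + 1` to order `(a + 2) * q`. -/
theorem step_one_zero {a : ℕ} (hr : 0 < r) {A C : Finset W} (hAC : A ⊆ C)
    (hA : #A = (a + 1) * (2 * r + 1) + 1) (hC : #C = (a + 2) * (2 * r + 1)) :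
    IsPathDecomposable (2 * r + 1 + 1)
      ((completeEdges C \ completeEdges A : Finset (Sym2 W)) : Set (Sym2 W)) := by
  have hD : #(C \ A) = 2 * r := by
    rw [card_sdiff_of_subset hAC, hC, hA, show a + 2 = (a + 1) + 1 from rfl, Nat.succ_mul (a + 1)]
    omega
  rw [Nat.succ_mul] at hA
  obtain ⟨v₀, hv₀, v₁, hv₁, hv⟩ := one_lt_card.1 (show 1 < #A by omega)
  have hA' : #((A.erase v₀).erase v₁) = a * (2 * r + 1) + 2 * r := by
    rw [card_erase_of_mem (mem_erase.2 ⟨hv.symm, hv₁⟩), card_erase_of_mem hv₀, hA]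
    omega
  obtain ⟨Y, hY, hYc⟩ := exists_subset_card_eq (s := (A.erase v₀).erase v₁) (n := 2 * r) (by omega)
  have hrest : #((A.erase v₀).erase v₁ \ Y) = a * (2 * r + 1) := by
    rw [card_sdiff_of_subset hY, hA', hYc, Nat.add_sub_cancel]
  have hmem (x) : x ∈ (A.erase v₀).erase v₁ ↔ x ≠ v₁ ∧ x ≠ v₀ ∧ x ∈ A := by
    rw [mem_erase, mem_erase]
  have hYA (x) (hx : x ∈ Y) : x ≠ v₁ ∧ x ≠ v₀ ∧ x ∈ A := (hmem x).1 (hY hx)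
  have hdisY : Disjoint (C \ A) Y :=
    disjoint_of_subset_right (fun x hx => (hYA x hx).2.2) sdiff_disjoint
  have hdisZ : Disjoint (C \ A) ((A.erase v₀).erase v₁ \ Y) :=
    disjoint_of_subset_right (fun x hx => ((hmem x).1 (mem_sdiff.1 hx).1).2.2) sdiff_disjoint
  obtain ⟨f, hf, h₁⟩ := exists_completeEdges_union_graphEdges hD hr hv (by simp [hv₀])
    (by simp [hv₁])
  -- Of the two edges from `x` to `v₀` and `v₁`, `f` uses one for a path through the new vertices;
  -- `g` gives the other to a path between them and `Y`.
  let g (x : W) : W := if f x = v₀ then v₁ else v₀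
  have hg (x) : f x = v₀ ∧ g x = v₁ ∨ f x = v₁ ∧ g x = v₀ := by
    rcases hf x with h | h
    · exact Or.inl ⟨h, if_pos h⟩
    · exact Or.inr ⟨h, if_neg (h ▸ hv.symm)⟩
  have hgA (x) : g x ∈ A := by rcases hg x with h | h <;> rw [h.2] <;> assumption
  have hgY (x) : g x ∉ Y := fun h => by
    have := hYA _ h
    rcases hg x with h | h <;> grind
  have h₂ := bipartiteEdges_union_graphEdges (even_two_mul r) (by omega) hD hYc hdisY g
    (fun x _ => by simp [hgA]) (fun x _ => hgY x)
  have h₃ : IsPathDecomposable (2 * r + 1 + 1)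
      (bipartiteEdges (C \ A) ((A.erase v₀).erase v₁ \ Y) : Set (Sym2 W)) :=
    bipartiteEdges_of_card_eq_mul a _ hrest hdisZ fun Z hZ hZ' =>
      bipartiteEdges_of_even (even_two_mul r) (by omega) hD hZ' (disjoint_of_subset_right hZ hdisZ)
  have hstar (x y : W) : s(x, y) ∈ graphEdges (C \ A) f ∨ s(x, y) ∈ graphEdges (C \ A) g ↔
      s(x, y) ∈ bipartiteEdges (C \ A) {v₀, v₁} := by
    simp only [mk_mem_graphEdges, mk_mem_bipartiteEdges, mem_insert, mem_singleton]
    have := hg x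
    have := hg y
    grind
  have hfg (x y : W) : s(x, y) ∈ graphEdges (C \ A) f → s(x, y) ∉ graphEdges (C \ A) g := by
    simp only [mk_mem_graphEdges, mem_sdiff]
    have := hg x
    have := hg y
    grind
  have h₂₃ : IsPathDecomposable (2 * r + 1 + 1) ((graphEdges (C \ A) g ∪
      bipartiteEdges (C \ A) ((A.erase v₀).erase v₁) : Finset (Sym2 W)) : Set (Sym2 W)) := by
    refine of_eq_union h₂ h₃ ?_ ?_ <;> intro x y
    · have := @hY x
      have := @hY y
      simp only [mem_union, mk_mem_bipartiteEdges, mem_sdiff (t := Y)]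
      tauto
    · have := hg x
      have := hg y
      have := hYA x
      have := hYA y
      simp only [mem_union, mk_mem_bipartiteEdges, mk_mem_graphEdges, mem_sdiff, hmem]
      grind
  refine of_eq_union h₁ h₂₃ ?_ ?_ <;> intro x y
  · rw [mem_union, mem_union, or_assoc, ← or_assoc (a := _ ∈ graphEdges _ _), hstar]
    simp only [mem_sdiff, mk_mem_completeEdges, mk_mem_bipartiteEdges, hmem, mem_insert,
      mem_singleton]
    have := @hAC x
    have := @hAC y
    grind
  · have := hg x
    have := hg y
    rw [mem_union, mem_union]
    rintro (h | h) (h' | h')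
    · simp only [mk_mem_completeEdges, mk_mem_graphEdges, mem_sdiff] at h h'
      grind
    · simp only [mk_mem_completeEdges, mk_mem_bipartiteEdges, hmem, mem_sdiff] at h h'
      grind
    · exact hfg x y h h'
    · simp only [mk_mem_graphEdges, mk_mem_bipartiteEdges, hmem, mem_sdiff] at h h'
      grind

/-! ### Chaining the steps. -/

/-- From order `a * q + 1` to order `b * q + 1`. -/
theorem chain_one_one {a : ℕ} {A : Finset W} (hA : #A = a * (2 * r + 1) + 1) {b : ℕ} (hab : a ≤ b) :
    ∀ C, A ⊆ C → #C = b * (2 * r + 1) + 1 → IsPathDecomposable (2 * r + 1 + 1)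
      ((completeEdges C \ completeEdges A : Finset (Sym2 W)) : Set (Sym2 W)) := by
  induction b, hab using Nat.le_induction with
  | base =>
    intro C hAC hC
    rw [eq_of_subset_of_card_le hAC (by rw [hC, hA])]
    simpa using IsPathDecomposable.empty
  | succ b hab ih =>
    intro C hAC hC
    have : a * (2 * r + 1) ≤ b * (2 * r + 1) := Nat.mul_le_mul_right _ hab
    have : b * (2 * r + 1) ≤ (b + 1) * (2 * r + 1) := Nat.mul_le_mul_right _ b.le_succ
    obtain ⟨B, hAB, hBC, hB⟩ := exists_subsuperset_card_eq hAC
      (n := b * (2 * r + 1) + 1) (by omega) (by omega)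
    exact sdiff_trans hAB hBC (ih B hAB hB) (step_one_one hBC hB hC)

/-- From order `a * q` to order `b * q + 1`. -/
theorem chain_zero_one {a b : ℕ} {A C : Finset W} (hA : #A = a * (2 * r + 1)) (hab : a < b)
    (hAC : A ⊆ C) (hC : #C = b * (2 * r + 1) + 1) : IsPathDecomposable (2 * r + 1 + 1)
      ((completeEdges C \ completeEdges A : Finset (Sym2 W)) : Set (Sym2 W)) := by
  have : (a + 1) * (2 * r + 1) ≤ b * (2 * r + 1) := Nat.mul_le_mul_right _ hab
  have h : (a + 1) * (2 * r + 1) = a * (2 * r + 1) + (2 * r + 1) := Nat.succ_mul _ _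
  obtain ⟨B, hAB, hBC, hB⟩ := exists_subsuperset_card_eq hAC
    (n := (a + 1) * (2 * r + 1) + 1) (by omega) (by omega)
  exact sdiff_trans hAB hBC (step_zero_one hAB hA hB) (chain_one_one hB hab C hBC hC)

/-- The edges in `C` outside `A` decompose into paths with `q` edges, for `q` odd and `A` and `C` of
sizes `0` or `1` modulo `q`. -/
theorem completeEdges_sdiff {A C : Finset W} (hAC : A ⊆ C)
    (hA : #A ≡ 0 [MOD 2 * r + 1] ∨ #A ≡ 1 [MOD 2 * r + 1])
    (hC : #C ≡ 0 [MOD 2 * r + 1] ∨ #C ≡ 1 [MOD 2 * r + 1])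
    (hlt : #A + 1 < #C) (hrC : 2 * r + 2 ≤ #C) : IsPathDecomposable (2 * r + 1 + 1)
      ((completeEdges C \ completeEdges A : Finset (Sym2 W)) : Set (Sym2 W)) := by
  -- For `q = 1` every size has both forms, so the representation is chosen by hand.
  rcases Nat.eq_zero_or_pos r with rfl | hr
  · exact chain_zero_one (a := #A) (b := #C - 1) (by simp) (by omega) hAC (by omega)
  have hmod (n : ℕ) (h : n ≡ 0 [MOD 2 * r + 1] ∨ n ≡ 1 [MOD 2 * r + 1]) :
      ∃ a, n = a * (2 * r + 1) ∨ n = a * (2 * r + 1) + 1 := by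
    have hdiv := Nat.div_add_mod' n (2 * r + 1)
    refine ⟨n / (2 * r + 1), ?_⟩
    unfold Nat.ModEq at h
    rw [Nat.zero_mod, Nat.mod_eq_of_lt (show 1 < 2 * r + 1 by omega)] at h
    omega
  obtain ⟨a, ha⟩ := hmod _ hA
  obtain ⟨b, hb⟩ := hmod _ hC
  -- Otherwise `#C ≤ b * q + 1 ≤ #A + 1`, against `hlt`.
  have hab : a < b := by
    by_contra! h
    have := Nat.mul_le_mul_right (2 * r + 1) h
    omega
  have hab' : (a + 1) * (2 * r + 1) ≤ b * (2 * r + 1) := Nat.mul_le_mul_right _ hab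
  have hsucc : (a + 1) * (2 * r + 1) = a * (2 * r + 1) + (2 * r + 1) := Nat.succ_mul _ _
  rcases hb with hb | hb
  -- `b = 1` would give `#C = q`, which `hrC` excludes.
  · obtain ⟨c, rfl⟩ : ∃ c, b = c + 2 := by
      refine ⟨b - 2, ?_⟩
      by_contra h
      obtain rfl : b = 1 := by omega
      omega
    have hc : (c + 2) * (2 * r + 1) = (c + 1) * (2 * r + 1) + (2 * r + 1) := Nat.succ_mul _ _
    have hac : a * (2 * r + 1) ≤ (c + 1) * (2 * r + 1) := Nat.mul_le_mul_right _ (by omega)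
    rcases ha with ha | ha
    -- From `(c + 1) * q` the usual intermediate order `(c + 1) * q + 1` is only one larger and
    -- cannot be reached, hence a direct step.
    · by_cases h : a = c + 1
      · subst h
        exact step_zero_zero hr hAC ha hb
      · have h' : (a + 1) * (2 * r + 1) ≤ (c + 1) * (2 * r + 1) :=
          Nat.mul_le_mul_right _ (by omega)
        obtain ⟨B, hAB, hBC, hB⟩ := exists_subsuperset_card_eq hAC
          (n := (c + 1) * (2 * r + 1) + 1) (by omega) (by omega)
        exact sdiff_trans hAB hBC (chain_zero_one ha (by omega) hAB hB)
          (step_one_zero hr hBC hB hb)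
    · obtain ⟨B, hAB, hBC, hB⟩ := exists_subsuperset_card_eq hAC
        (n := (c + 1) * (2 * r + 1) + 1) (by omega) (by omega)
      exact sdiff_trans hAB hBC (chain_one_one ha (by omega) B hAB hB)
        (step_one_zero hr hBC hB hb)
  · rcases ha with ha | ha
    · exact chain_zero_one ha hab hAC hb
    · exact chain_one_one ha hab.le C hAC hb

end IsPathDecomposable

theorem theorem3p3 (k : ℕ) (hk : Even k) (hk2 : 2 ≤ k) (n m : ℕ)
    (hn : n ≡ 0 [MOD k - 1] ∨ n ≡ 1 [MOD k - 1])
    (hm : m ≡ 0 [MOD k - 1] ∨ m ≡ 1 [MOD k - 1])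
    (hnm : n + 1 < m) (hkm : k ≤ m)
    {V : Type u} {W : Type w} [Fintype V] [Fintype W]
    (hV : Fintype.card V = n) (hW : Fintype.card W = m) (f : V ↪ W)
    (𝓑 : Set (SimpleGraph.completeGraph V).Subgraph) (h𝓑 : IsPathDesign k 𝓑) :
    ∃ 𝓑' : Set (SimpleGraph.completeGraph W).Subgraph,
      IsPathDesign k 𝓑' ∧ IsEmbeddedInDesign f 𝓑 𝓑' := by
  classical
  obtain ⟨r, rfl⟩ : ∃ r, k = 2 * r + 1 + 1 := by
    obtain ⟨s, rfl⟩ := hk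
    exact ⟨s - 1, by omega⟩
  rw [Nat.add_sub_cancel] at hn hm
  have hA : #(univ.map f) = n := by rw [card_map, card_univ, hV]
  have hC : #(univ : Finset W) = m := by rw [card_univ, hW]
  have h := IsPathDecomposable.completeEdges_sdiff (r := r) (subset_univ (univ.map f))
    (by rwa [hA]) (by rwa [hC]) (by rwa [hA, hC]) (by rwa [hC])
  refine IsPathDecomposable.exists_embedding h𝓑 ?_
  convert h using 1
  ext e
  induction e with | _ a b =>
  simp only [Set.mem_sdiff, Set.mem_ofPred_eq, Sym2.mk_isDiag_iff, Set.mem_range, mem_coe, mem_sdiff,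
    mk_mem_completeEdges, mem_univ, true_and, mem_map]
  refine and_congr_right fun hab => not_congr ⟨?_, ?_⟩
  · rintro ⟨e, he⟩
    induction e with | _ x y =>
    rcases Sym2.eq_iff.1 he with ⟨rfl, rfl⟩ | ⟨rfl, rfl⟩
    · exact ⟨⟨x, rfl⟩, ⟨y, rfl⟩, hab⟩
    · exact ⟨⟨y, rfl⟩, ⟨x, rfl⟩, hab⟩
  · rintro ⟨⟨x, rfl⟩, ⟨y, rfl⟩, -⟩
    exact ⟨s(x, y), rfl⟩
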